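/- Let $|B_1\rangle=\frac{1}{\sqrt2}(|00\rangle+|11\rangle)$, $|B_2\rangle=\frac{1}{\sqrt2}(|00\rangle-|11\rangle)$, $|B_3\rangle=\frac{1}{\sqrt2}(|01\rangle+|10\rangle)$, $|B_4\rangle=\frac{1}{\sqrt2}(|01\rangle-|10\rangle)$ be the four Bell states in $\mathbb{C}^2\otimes\mathbb{C}^2$; they are orthonormal. For $1\le j<k\le 4$ let $$\rho_{\{j,k\}}=\tfrac12\,|B_j\rangle\langle B_j|_{A_1B_1}\otimes|B_k\rangle\langle B_k|_{A_2B_2}+\tfrac12\,|B_k\rangle\langle B_k|_{A_1B_1}\otimes|B_j\rangle\langle B_j|_{A_2B_2}$$ be the state shared by Alice (who holds $A_1A_2$) and Bob (who holds $B_1B_2$) when the two distinct Bell states $|B_j\rangle,|B_k\rangle$ are distributed to them in unknown order. Then the set $\{|B_1\rangle,\dots,|B_4\rangle\}$ is $(4,2)$-unidentifiable: there is no measurement implementable by local operations and classical communication (LOCC) between Alice and Bob, with any number of rounds (including limits of protocols in which each one continues the preceding one by further rounds), which for each of the six two-element subsets $\{j,k\}\subset\{1,2,3,4\}$ returns $\{j,k\}$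 with probability one on the state $\rho_{\{j,k\}}$. -/

import Mathlib

open scoped Kronecker Matrix

noncomputable section

namespace LSI

/-- A bipartite LOCC protocol with finitely many rounds, started when Alice holds a system
`ℂ^a` and Bob holds a system `ℂ^b`, and ending with an answer in `O`.
In each round one party applies a local quantum instrument: outcome `x` is the completely
positive map `σ ↦ ∑ j, K x j * σ * (K x j)ᴴ` from its current system to a system of
dimension `d x`, and the sum over all outcomes is trace preserving.
The outcome `x` is announced, and the rest of the protocol may depend on it. -/
inductive Protocol (O : Type) : ℕ → ℕ → Type
  | halt {a b : ℕ} (answer : O) : Protocol O a b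
  | alice {a b : ℕ} (m : ℕ) (r d : Fin m → ℕ)
      (K : (x : Fin m) → Fin (r x) → Matrix (Fin (d x)) (Fin a) ℂ)
      (hK : ∑ x, ∑ j, (K x j)ᴴ * K x j = 1)
      (next : (x : Fin m) → Protocol O (d x) b) : Protocol O a b
  | bob {a b : ℕ} (m : ℕ) (r d : Fin m → ℕ)
      (K : (x : Fin m) → Fin (r x) → Matrix (Fin (d x)) (Fin b) ℂ)
      (hK : ∑ x, ∑ j, (K x j)ᴴ * K x j = 1)
      (next : (x : Fin m) → Protocol O a (d x)) : Protocol O a b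

/-- The POVM on `ℂ^a ⊗ ℂ^b` realised by a finite protocol: on the state `ρ`, the protocol
answers `o` with probability `trace (T.effect o * ρ)`. -/
def Protocol.effect {O : Type} [DecidableEq O] :
    {a b : ℕ} → Protocol O a b → O → Matrix (Fin a × Fin b) (Fin a × Fin b) ℂ
  | _, _, .halt answer, o => if answer = o then 1 else 0
  | _, b, .alice _ _ _ K _ next, o =>
      ∑ x, ∑ j, (K x j ⊗ₖ (1 : Matrix (Fin b) (Fin b) ℂ))ᴴ * (next x).effect o *
        (K x j ⊗ₖ (1 : Matrix (Fin b) (Fin b) ℂ))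
  | a, _, .bob _ _ _ K _ next, o =>
      ∑ x, ∑ j, ((1 : Matrix (Fin a) (Fin a) ℂ) ⊗ₖ K x j)ᴴ * (next x).effect o *
        ((1 : Matrix (Fin a) (Fin a) ℂ) ⊗ₖ K x j)

/-- `Extends T T'`: the protocol `T'` runs like `T`, except that where `T` stops, `T'` may
carry on with further rounds (and revise the answer). -/
inductive Extends {O : Type} : {a b : ℕ} → Protocol O a b → Protocol O a b → Prop
  | halt {a b : ℕ} (answer : O) (T : Protocol O a b) : Extends (.halt answer) T
  | alice {a b : ℕ} (m : ℕ) (r d : Fin m → ℕ)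
      (K : (x : Fin m) → Fin (r x) → Matrix (Fin (d x)) (Fin a) ℂ)
      (hK : ∑ x, ∑ j, (K x j)ᴴ * K x j = 1)
      (next next' : (x : Fin m) → Protocol O (d x) b)
      (h : ∀ x, Extends (next x) (next' x)) :
      Extends (.alice m r d K hK next) (.alice m r d K hK next')
  | bob {a b : ℕ} (m : ℕ) (r d : Fin m → ℕ)
      (K : (x : Fin m) → Fin (r x) → Matrix (Fin (d x)) (Fin b) ℂ)
      (hK : ∑ x, ∑ j, (K x j)ᴴ * K x j = 1)
      (next next' : (x : Fin m) → Protocol O a (d x))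
      (h : ∀ x, Extends (next x) (next' x)) :
      Extends (.bob m r d K hK next) (.bob m r d K hK next')

/-- `M` is a measurement that can be implemented by LOCC, with no bound on the number of rounds:
there are finite protocols, each one continuing the one before, whose POVMs converge to `M`.
A constant sequence gives the protocols with finitely many rounds. -/
def IsLOCC {O : Type} [DecidableEq O] {a b : ℕ}
    (M : O → Matrix (Fin a × Fin b) (Fin a × Fin b) ℂ) : Prop :=
  ∃ T : ℕ → Protocol O a b, (∀ i, Extends (T i) (T (i + 1))) ∧
    ∀ o, Filter.Tendsto (fun i => (T i).effect o) Filter.atTop (nhds (M o))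

/-- The product vector `ψ_{f 0} ⊗ ⋯ ⊗ ψ_{f (k-1)}`, where the `j`-th factor lives on
`A_j B_j`, regrouped as a vector of `(A_0 ⋯ A_{k-1}) ⊗ (B_0 ⋯ B_{k-1}) = ℂ^(dA^k) ⊗ ℂ^(dB^k)`. -/
def orderedState {n dA dB : ℕ} (ψ : Fin n → EuclideanSpace ℂ (Fin dA × Fin dB)) {k : ℕ}
    (f : Fin k → Fin n) : Fin (dA ^ k) × Fin (dB ^ k) → ℂ :=
  fun p => ∏ j, ψ (f j) (finFunctionFinEquiv.symm p.1 j, finFunctionFinEquiv.symm p.2 j)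

/-- The state shared when the `k` elements of the subset `{ψ_i | i ∈ s}` are distributed in
unknown order: the equal mixture of the `k!` orderings. -/
def subsetState {n dA dB : ℕ} (ψ : Fin n → EuclideanSpace ℂ (Fin dA × Fin dB)) (k : ℕ)
    (s : Finset (Fin n)) :
    Matrix (Fin (dA ^ k) × Fin (dB ^ k)) (Fin (dA ^ k) × Fin (dB ^ k)) ℂ :=
  ((k.factorial : ℂ)⁻¹) • ∑ e : Fin k ≃ s,
    Matrix.vecMulVec (orderedState ψ fun j => (e j : Fin n))
      (star (orderedState ψ fun j => (e j : Fin n)))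

/-- The set `{ψ_0, …, ψ_{n-1}}` is `(n,k)`-identifiable: some LOCC measurement, whose outcomes
are subsets, returns with probability one the subset that was distributed, whichever of the
`k`-element subsets this is. -/
def IsIdentifiable {n dA dB : ℕ} (ψ : Fin n → EuclideanSpace ℂ (Fin dA × Fin dB)) (k : ℕ) :
    Prop :=
  ∃ M : Finset (Fin n) →
      Matrix (Fin (dA ^ k) × Fin (dB ^ k)) (Fin (dA ^ k) × Fin (dB ^ k)) ℂ,
    IsLOCC M ∧ ∀ s : Finset (Fin n), s.card = k → (M s * subsetState ψ k s).trace = 1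

/-- The computational basis vector `|p q⟩` of two qubits. -/
def ket (p q : Fin 2) : EuclideanSpace ℂ (Fin 2 × Fin 2) := EuclideanSpace.single (p, q) 1

/-- The four Bell states. -/
def bell : Fin 4 → EuclideanSpace ℂ (Fin 2 × Fin 2) :=
  ![((√2 : ℝ) : ℂ)⁻¹ • (ket 0 0 + ket 1 1), ((√2 : ℝ) : ℂ)⁻¹ • (ket 0 0 - ket 1 1),
    ((√2 : ℝ) : ℂ)⁻¹ • (ket 0 1 + ket 1 0), ((√2 : ℝ) : ℂ)⁻¹ • (ket 0 1 - ket 1 0)]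

end LSI

end

open scoped Kronecker Matrix ComplexOrder MatrixOrder

namespace LSI

/-! ### Trace inequalities -/

attribute [local instance] Matrix.frobeniusNormedAddCommGroup in
theorem frobenius_norm_sq_eq_trace_re {m n : Type*} [Fintype m] [Fintype n]
    (X : Matrix m n ℂ) : ‖X‖ ^ 2 = (Xᴴ * X).trace.re := by
  rw [Matrix.frobenius_norm_def, ← Real.sqrt_eq_rpow, Real.sq_sqrt (by positivity),
    Finset.sum_comm]
  simp [Matrix.trace, Matrix.mul_apply, ← Complex.normSq_eq_conj_mul_self,
    Complex.normSq_eq_norm_sq, -Complex.ofReal_pow]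

attribute [local instance] Matrix.frobeniusNormedAddCommGroup in
theorem trace_mul_re_le_of_posSemidef {n : Type*} [Fintype n] [DecidableEq n]
    {A C : Matrix n n ℂ} (hA : A.PosSemidef) (hC : C.PosSemidef) :
    (A * C).trace.re ≤ A.trace.re * C.trace.re := by
  obtain ⟨X, rfl⟩ := CStarAlgebra.nonneg_iff_eq_star_mul_self.mp hA.nonneg
  obtain ⟨Y, rfl⟩ := CStarAlgebra.nonneg_iff_eq_star_mul_self.mp hC.nonneg
  simp only [Matrix.star_eq_conjTranspose]
  have h : (Xᴴ * X * (Yᴴ * Y)).trace = ((X * Yᴴ)ᴴ * (X * Yᴴ)).trace := by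
    rw [Matrix.conjTranspose_mul, Matrix.conjTranspose_conjTranspose,
      Matrix.mul_assoc Y, Matrix.trace_mul_comm Y]
    simp only [Matrix.mul_assoc]
  rw [h, ← frobenius_norm_sq_eq_trace_re, ← frobenius_norm_sq_eq_trace_re,
    ← frobenius_norm_sq_eq_trace_re, ← Matrix.frobenius_norm_conjTranspose Y, ← mul_pow]
  gcongr
  exact Matrix.frobenius_norm_mul X Yᴴ

/-! ### Separable operators -/

/-- The separable operators: sums of tensor products of positive semidefinite matrices. -/
def separable (m n : Type*) [Fintype m] [Fintype n] :
    AddSubmonoid (Matrix (m × n) (m × n) ℂ) :=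
  AddSubmonoid.closure {E | ∃ A B, A.PosSemidef ∧ B.PosSemidef ∧ E = A ⊗ₖ B}

section Separable

variable {m n m' n' : Type*} [Fintype m] [Fintype n] [Fintype m'] [Fintype n']

theorem kronecker_mem_separable {A : Matrix m m ℂ} {B : Matrix n n ℂ}
    (hA : A.PosSemidef) (hB : B.PosSemidef) : A ⊗ₖ B ∈ separable m n :=
  AddSubmonoid.subset_closure ⟨A, B, hA, hB, rfl⟩

theorem one_mem_separable [DecidableEq m] [DecidableEq n] :
    (1 : Matrix (m × n) (m × n) ℂ) ∈ separable m n := by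
  rw [← Matrix.one_kronecker_one]
  exact kronecker_mem_separable .one .one

theorem conjTranspose_mul_mul_mem_separable (K : Matrix m' m ℂ) (L : Matrix n' n ℂ)
    {E : Matrix (m' × n') (m' × n') ℂ} (hE : E ∈ separable m' n') :
    (K ⊗ₖ L)ᴴ * E * (K ⊗ₖ L) ∈ separable m n := by
  induction hE using AddSubmonoid.closure_induction with
  | mem E h =>
    obtain ⟨A, B, hA, hB, rfl⟩ := h
    rw [Matrix.conjTranspose_kronecker, ← Matrix.mul_kronecker_mul, ← Matrix.mul_kronecker_mul]
    exact kronecker_mem_separable (hA.conjTranspose_mul_mul_same K)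
      (hB.conjTranspose_mul_mul_same L)
  | zero => simp
  | add E F _ _ hE hF =>
    rw [Matrix.mul_add, Matrix.add_mul]
    exact add_mem hE hF

theorem trace_re_nonneg_of_mem_separable {E : Matrix (m × n) (m × n) ℂ}
    (hE : E ∈ separable m n) : 0 ≤ E.trace.re := by
  induction hE using AddSubmonoid.closure_induction with
  | mem E h =>
    obtain ⟨A, B, hA, hB, rfl⟩ := h
    rw [Matrix.trace_kronecker]
    exact (Complex.nonneg_iff.mp (mul_nonneg hA.trace_nonneg hB.trace_nonneg)).1
  | zero => simp
  | add E F _ _ hE hF =>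
    rw [Matrix.trace_add, Complex.add_re]
    exact add_nonneg hE hF

/-- If the reduced state of `v` on the first factor is `c • 1`, then the probability of a
separable effect on `v` is at most `c` times its trace. -/
theorem trace_mul_vecMulVec_re_le_of_mem_separable [DecidableEq m] [DecidableEq n]
    {v : m × n → ℂ} {c : ℝ}
    (hv : ∀ p p', ∑ q, v (p, q) * star (v (p', q)) = if p = p' then (c : ℂ) else 0)
    {E : Matrix (m × n) (m × n) ℂ} (hE : E ∈ separable m n) :
    (E * Matrix.vecMulVec v (star v)).trace.re ≤ c * E.trace.re := by
  induction hE using AddSubmonoid.closure_induction with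
  | mem E h =>
    obtain ⟨A, B, hA, hB, rfl⟩ := h
    let X : Matrix n m ℂ := .of fun q p => v (p, q)
    have hX : Xᵀ * Xᵀᴴ = (c : ℂ) • 1 := by
      ext p p'
      simpa [X, Matrix.mul_apply, Matrix.one_apply] using hv p p'
    have hvec : v = X.vec := rfl
    have h1 : (A ⊗ₖ B * Matrix.vecMulVec v (star v)).trace = (B * (X * Aᵀ * Xᴴ)).trace := by
      rw [Matrix.mul_vecMulVec, Matrix.trace_vecMulVec, hvec, Matrix.kronecker_mulVec_vec,
        dotProduct_comm, Matrix.star_vec_dotProduct_vec, Matrix.trace_mul_comm]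
      simp only [Matrix.mul_assoc]
    have h2 : (X * Aᵀ * Xᴴ).trace = c * A.trace := by
      have : Xᴴ * X = (c : ℂ) • 1 := by
        simpa [Matrix.transpose_mul, Matrix.conjTranspose, Matrix.transpose_map] using
          congrArg Matrix.transpose hX
      rw [Matrix.trace_mul_comm, ← Matrix.mul_assoc, this]
      simp
    rw [h1, Matrix.trace_kronecker]
    refine (trace_mul_re_le_of_posSemidef hB
      (hA.transpose.mul_mul_conjTranspose_same X)).trans_eq ?_
    have hAi := (Complex.nonneg_iff.mp hA.trace_nonneg).2
    rw [h2, Complex.mul_re, Complex.mul_re, ← hAi]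
    simp
    ring
  | zero => simp
  | add E F _ _ hE hF =>
    simp only [Matrix.add_mul, Matrix.trace_add, Complex.add_re, mul_add]
    exact add_le_add hE hF

end Separable

/-! ### Effects of finite protocols -/

theorem Protocol.effect_mem_separable {O : Type} [DecidableEq O] {a b : ℕ}
    (T : Protocol O a b) (o : O) : T.effect o ∈ separable (Fin a) (Fin b) := by
  induction T with
  | halt answer =>
    rw [Protocol.effect]
    split_ifs
    · exact one_mem_separable
    · exact zero_mem _
  | alice _ _ _ K _ next ih =>
    rw [Protocol.effect]
    exact sum_mem fun x _ => sum_mem fun j _ => conjTranspose_mul_mul_mem_separable _ _ (ih x)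
  | bob _ _ _ K _ next ih =>
    rw [Protocol.effect]
    exact sum_mem fun x _ => sum_mem fun j _ => conjTranspose_mul_mul_mem_separable _ _ (ih x)

theorem Protocol.sum_effect {O : Type} [DecidableEq O] [Fintype O] {a b : ℕ}
    (T : Protocol O a b) : ∑ o, T.effect o = 1 := by
  induction T with
  | halt answer => simp [Protocol.effect]
  | alice _ _ _ K hK next ih =>
    simp only [Protocol.effect]
    rw [Finset.sum_comm]
    simp_rw [Finset.sum_comm (s := (Finset.univ : Finset O)), ← Matrix.sum_mul, ← Matrix.mul_sum,
      ih, Matrix.mul_one, Matrix.conjTranspose_kronecker, ← Matrix.mul_kronecker_mul]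
    rw [← Matrix.one_kronecker_one, ← hK]
    ext ⟨i, i'⟩ ⟨j, j'⟩
    simp [Matrix.sum_apply, Finset.sum_mul]
  | bob _ _ _ K hK next ih =>
    simp only [Protocol.effect]
    rw [Finset.sum_comm]
    simp_rw [Finset.sum_comm (s := (Finset.univ : Finset O)), ← Matrix.sum_mul, ← Matrix.mul_sum,
      ih, Matrix.mul_one, Matrix.conjTranspose_kronecker, ← Matrix.mul_kronecker_mul]
    rw [← Matrix.one_kronecker_one, ← hK]
    ext ⟨i, i'⟩ ⟨j, j'⟩
    simp [Matrix.sum_apply, Finset.mul_sum]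

/-! ### LOCC measurements -/

section IsLOCC

variable {O : Type} [DecidableEq O] {a b : ℕ}
  {M : O → Matrix (Fin a × Fin b) (Fin a × Fin b) ℂ}

theorem IsLOCC.mem_of_isClosed (hM : IsLOCC M) (o : O)
    {S : Set (Matrix (Fin a × Fin b) (Fin a × Fin b) ℂ)} (hS : IsClosed S)
    (h : ∀ E ∈ separable (Fin a) (Fin b), E ∈ S) : M o ∈ S := by
  obtain ⟨T, -, hT⟩ := hM
  exact hS.mem_of_tendsto (hT o) (.of_forall fun i => h _ ((T i).effect_mem_separable o))

theorem IsLOCC.sum_eq_one [Fintype O] (hM : IsLOCC M) : ∑ o, M o = 1 := by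
  obtain ⟨T, -, hT⟩ := hM
  refine tendsto_nhds_unique (tendsto_finsetSum Finset.univ fun o _ => hT o) ?_
  simp only [Protocol.sum_effect]
  exact tendsto_const_nhds

theorem IsLOCC.trace_re_nonneg (hM : IsLOCC M) (o : O) : 0 ≤ (M o).trace.re :=
  hM.mem_of_isClosed o (S := {E | 0 ≤ E.trace.re})
    (isClosed_le continuous_const (Complex.continuous_re.comp continuous_id.matrix_trace))
    fun _ hE => trace_re_nonneg_of_mem_separable hE

theorem IsLOCC.trace_mul_vecMulVec_re_le (hM : IsLOCC M) (o : O) {v : Fin a × Fin b → ℂ} {c : ℝ}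
    (hv : ∀ p p', ∑ q, v (p, q) * star (v (p', q)) = if p = p' then (c : ℂ) else 0) :
    (M o * Matrix.vecMulVec v (star v)).trace.re ≤ c * (M o).trace.re :=
  hM.mem_of_isClosed o
    (S := {E | (E * Matrix.vecMulVec v (star v)).trace.re ≤ c * E.trace.re})
    (isClosed_le
      (Complex.continuous_re.comp (continuous_id.matrix_mul continuous_const).matrix_trace)
      (continuous_const.mul (Complex.continuous_re.comp continuous_id.matrix_trace)))
    fun _ hE => trace_mul_vecMulVec_re_le_of_mem_separable hv hE

end IsLOCC

/-! ### Subset states of maximally entangled states -/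

section MaximallyEntangled

variable {n dA dB : ℕ} {ψ : Fin n → EuclideanSpace ℂ (Fin dA × Fin dB)} {c : ℝ}

theorem orderedState_reduced
    (hψ : ∀ i p p', ∑ q, ψ i (p, q) * star (ψ i (p', q)) = if p = p' then (c : ℂ) else 0)
    {k : ℕ} (f : Fin k → Fin n) (p p' : Fin (dA ^ k)) :
    ∑ q, orderedState ψ f (p, q) * star (orderedState ψ f (p', q)) =
      if p = p' then ((c ^ k : ℝ) : ℂ) else 0 := by
  rw [← finFunctionFinEquiv.sum_comp]
  simp only [orderedState, star_prod, ← Finset.prod_mul_distrib, Equiv.symm_apply_apply]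
  rw [← Fintype.prod_sum fun j q => ψ (f j) (finFunctionFinEquiv.symm p j, q) *
    star (ψ (f j) (finFunctionFinEquiv.symm p' j, q))]
  simp only [hψ]
  split_ifs with h
  · simp [h]
  · obtain ⟨j, hj⟩ := Function.ne_iff.mp (finFunctionFinEquiv.symm.injective.ne h)
    exact Finset.prod_eq_zero (Finset.mem_univ j) (if_neg hj)

theorem IsLOCC.trace_mul_subsetState_re_le {k : ℕ} {O : Type} [DecidableEq O]
    {M : O → Matrix (Fin (dA ^ k) × Fin (dB ^ k)) (Fin (dA ^ k) × Fin (dB ^ k)) ℂ}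
    (hM : IsLOCC M)
    (hψ : ∀ i p p', ∑ q, ψ i (p, q) * star (ψ i (p', q)) = if p = p' then (c : ℂ) else 0)
    (o : O) {s : Finset (Fin n)} (hs : s.card = k) :
    (M o * subsetState ψ k s).trace.re ≤ c ^ k * (M o).trace.re := by
  have hcard : Fintype.card (Fin k ≃ s) = k.factorial := by
    rw [Fintype.card_equiv (Fintype.equivOfCardEq (by simp [hs])), Fintype.card_fin]
  have hk : (0 : ℝ) < k.factorial := by exact_mod_cast k.factorial_pos
  have hsum := Finset.sum_le_sum fun (e : Fin k ≃ s) (_ : e ∈ Finset.univ) =>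
    hM.trace_mul_vecMulVec_re_le o (orderedState_reduced hψ fun j => (e j : Fin n))
  rw [Finset.sum_const, Finset.card_univ, hcard, nsmul_eq_mul] at hsum
  rw [subsetState, Matrix.mul_smul, Matrix.trace_smul, Matrix.mul_sum, Matrix.trace_sum,
    smul_eq_mul, ← Complex.ofReal_natCast, ← Complex.ofReal_inv, Complex.re_ofReal_mul,
    Complex.re_sum, inv_mul_le_iff₀ hk]
  exact hsum

/-- States whose reduced state on Alice's side is `c • 1` can be `(n,k)`-identified only if the
number of `k`-element subsets is at most `c ^ k * (dA ^ k * dB ^ k)`. -/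
theorem IsIdentifiable.choose_le {k : ℕ} (h : IsIdentifiable ψ k) (hc : 0 ≤ c)
    (hψ : ∀ i p p', ∑ q, ψ i (p, q) * star (ψ i (p', q)) = if p = p' then (c : ℂ) else 0) :
    (n.choose k : ℝ) ≤ c ^ k * (dA ^ k * dB ^ k) := by
  obtain ⟨M, hM, hid⟩ := h
  calc (n.choose k : ℝ) = ∑ s ∈ (Finset.univ : Finset (Fin n)).powersetCard k, (1 : ℝ) := by simp
    _ ≤ ∑ s ∈ Finset.univ.powersetCard k, c ^ k * (M s).trace.re := by
      refine Finset.sum_le_sum fun s hs => ?_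
      have hs' := (Finset.mem_powersetCard.mp hs).2
      simpa [hid s hs'] using hM.trace_mul_subsetState_re_le hψ s hs'
    _ ≤ ∑ s, c ^ k * (M s).trace.re :=
      Finset.sum_le_sum_of_subset_of_nonneg (Finset.subset_univ _) fun s _ _ =>
        mul_nonneg (pow_nonneg hc k) (hM.trace_re_nonneg s)
    _ = c ^ k * (dA ^ k * dB ^ k) := by
      rw [← Finset.mul_sum, ← Complex.re_sum, ← Matrix.trace_sum, hM.sum_eq_one,
        Matrix.trace_one]
      norm_cast
      simp

end MaximallyEntangled

/-! ### Bell states -/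

theorem inv_sqrt_two_mul_self : ((√2 : ℝ) : ℂ)⁻¹ * ((√2 : ℝ) : ℂ)⁻¹ = 2⁻¹ := by
  rw [← mul_inv, ← Complex.ofReal_mul, Real.mul_self_sqrt (by norm_num)]
  simp

theorem bell_reduced (i : Fin 4) (p p' : Fin 2) :
    ∑ q, bell i (p, q) * star (bell i (p', q)) = if p = p' then ((2⁻¹ : ℝ) : ℂ) else 0 := by
  fin_cases i <;> fin_cases p <;> fin_cases p' <;>
    simp [bell, ket, inv_sqrt_two_mul_self]

theorem orthonormal_bell : Orthonormal ℂ bell := by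
  rw [orthonormal_iff_ite]
  intro i j
  rw [PiLp.inner_apply, Fintype.sum_prod_type]
  fin_cases i <;> fin_cases j <;>
    simp [bell, ket, Fin.sum_univ_two, inv_sqrt_two_mul_self] <;>
    norm_num [← Complex.ofReal_pow, sq_abs]

end LSI

/-- The four Bell states are orthonormal, and they are not `(4,2)`-identifiable by LOCC. -/
theorem mainTheorem1 : Orthonormal ℂ LSI.bell ∧ ¬ LSI.IsIdentifiable LSI.bell 2 := by
  refine ⟨LSI.orthonormal_bell, fun h => ?_⟩
  have := h.choose_le (by norm_num) LSI.bell_reduced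
  norm_num [Nat.choose] at this
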